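/- Let $\mathcal S$ be the space of (classes of) measurable a.e. finite real functions on $[0,1]$ with Lebesgue measure $\mu$, and for $x\in\mathcal S$ let $x^*(t)=\inf\{\tau:\mu\{|x|>\tau\}<t\}$, $0<t\le 1$. A symmetric space is a Banach space $X\subset\mathcal S$ such that: if $x\in X$, $y\in\mathcal S$ and $|y|\le|x|$, then $y\in X$ and $\|y\|_X\le\|x\|_X$; and if $x\in X$, $y\in\mathcal S$ and $y^*=x^*$, then $y\in X$ and $\|y\|_X=\|x\|_X$. Let $\mathrm{Exp}L^2$ be the Orlicz space $L_N$ on $[0,1]$, with norm $\|x\|_{L_N}=\inf\{\lambda>0:\int_0^1N(|x(t)|/\lambda)\,dt\le1\}$, generated by a convex function $N\ge 0$ on $[0,\infty)$ with $N(0)=0$, $N\not\equiv0$, such that for some $u_0,c,C>0$ one has $cu^2\le\log N(u)\le Cu^2$ for all $u>u_0$ (for example $N(u)=e^{u^2}-1$). The inclusion $\mathrm{Exp}L^2\subset X$ means a continuous embedding: every $x\in \mathrm{Exp}L^2$ lies in $X$ and $\|x\|_X\le C'\|x\|_{\mathrm{Exp}L^2}$ with a constant $C'$. Let $r_j(t)=(-1)^{[2^jt]}$,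 $j=1,2,\dots$, be the Rademacher functions. Let $d\ge1$, let $\triangle^d=\{(j_1,\dots,j_d)\in\mathbb N^d: j_1>j_2>\dots>j_d\}$ (with $\mathbb N=\{1,2,\dots\}$), and for $\jmath\in\triangle^d$ put $\mathbf r_\jmath(t)=r_{j_1}(t)r_{j_2}(t)\cdots r_{j_d}(t)$. For a constant $D>0$, a sequence $\{x_k\}_{k=1}^\infty$ in $X$ satisfies the $D$-RUC estimate if for all $n\in\mathbb N$ and $a_1,\dots,a_n\in\mathbb R$ $$\int_0^1\Bigl\|\sum_{k=1}^nr_k(u)a_kx_k\Bigr\|_X\,du\le D\,\Bigl\|\sum_{k=1}^na_kx_k\Bigr\|_X .$$ It is a RUC sequence if it is a basic sequence (a Schauder basis of its closed linear span) and satisfies the $D$-RUC estimate with some $D>0$. **Corollary 2.** Let $X$ be a symmetric space with $\mathrm{Exp}L^2\subset X$. Then the full Rademacher chaos $\{\mathbf r_\jmath\}_{\jmath\in\triangle^d}$ of order $d$ lies in $X$ and, enumerated in the lexicographic order of $\triangle^d$, is a RUC sequence in $X$. Moreover, the order of enumeration does not matter for the RUC estimate: there is $D>0$ such that $\{\mathbf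 r_\jmath\}_{\jmath\in\triangle^d}$ satisfies the $D$-RUC estimate in $X$ for every enumeration of $\triangle^d$ as a sequence. -/

import Mathlib

open MeasureTheory Set Filter Topology
open scoped unitInterval

noncomputable section

/-- The space `𝒮` of (equivalence classes of) measurable real-valued functions on `[0,1]` with
Lebesgue measure. -/
abbrev L0 : Type := I →ₘ[(volume : Measure I)] ℝ

/-- The distribution function `n_x(τ) = μ {t : x(t) > τ}`. -/
def distribution (x : L0) (τ : ℝ) : ENNReal :=
  volume {t : I | τ < x t}

/-- The decreasing rearrangement `x^*(t) = inf {τ : n_{|x|}(τ) < t}`, for `t ∈ (0,1]`. -/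
def rearrangement (x : L0) (t : ℝ) : ℝ :=
  sInf {τ : ℝ | distribution |x| τ < ENNReal.ofReal t}

/-- A symmetric space on `[0,1]`: a Banach space `X ⊂ 𝒮` which is ideal and rearrangement
invariant. -/
structure SymmetricSpace where
  /-- the linear subspace of `𝒮` -/
  carrier : Submodule ℝ L0
  /-- the norm of `X` -/
  toNorm : Norm carrier
  isNorm : NormedSpace.Core ℝ carrier
  complete :
    letI : NormedAddCommGroup carrier := NormedAddCommGroup.ofCore isNorm
    CompleteSpace carrier
  ideal : ∀ (x : carrier) (y : L0), |y| ≤ |(x : L0)| →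
    ∃ hy : y ∈ carrier, ‖(⟨y, hy⟩ : carrier)‖ ≤ ‖x‖
  symmetric : ∀ (x : carrier) (y : L0),
    (∀ t ∈ Ioc (0 : ℝ) 1, rearrangement y t = rearrangement (x : L0) t) →
    ∃ hy : y ∈ carrier, ‖(⟨y, hy⟩ : carrier)‖ = ‖x‖

instance (X : SymmetricSpace) : NormedAddCommGroup X.carrier :=
  letI := X.toNorm
  NormedAddCommGroup.ofCore X.isNorm

instance (X : SymmetricSpace) : NormedSpace ℝ X.carrier :=
  letI := X.toNorm
  NormedSpace.ofCore X.isNorm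

instance (X : SymmetricSpace) : CompleteSpace X.carrier := X.complete

/-- Orlicz functions: convex, non-negative on `[0,∞)`, not identically zero, `M(0) = 0`. Only the
values on `[0,∞)` are relevant. -/
structure IsOrliczFunction (M : ℝ → ℝ) : Prop where
  convex : ConvexOn ℝ (Ici 0) M
  nonneg : ∀ u, 0 ≤ u → 0 ≤ M u
  map_zero : M 0 = 0
  ne_zero : ∃ u, 0 ≤ u ∧ M u ≠ 0

/-- The modular `∫₀¹ M(|x(t)|/c) dt` with values in `[0,∞]`. -/
def orliczModular (M : ℝ → ℝ) (x : L0) (c : ℝ) : ENNReal :=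
  ∫⁻ t : I, ENNReal.ofReal (M (|x t| / c))

/-- Membership in the Orlicz space `L_M`. -/
def MemOrlicz (M : ℝ → ℝ) (x : L0) : Prop :=
  ∃ c : ℝ, 0 < c ∧ orliczModular M x c < ⊤

/-- The norm of the Orlicz space `L_M`. -/
def orliczNorm (M : ℝ → ℝ) (x : L0) : ℝ :=
  sInf {c : ℝ | 0 < c ∧ orliczModular M x c ≤ 1}

/-- `N` is an Orlicz function generating the exponential Orlicz space `Exp L^r`: for some `u₀ > 0`,
`log N(u) ≍ u^r` for `u > u₀`. -/
structure GeneratesExpL (r : ℝ) (N : ℝ → ℝ) : Prop where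
  orlicz : IsOrliczFunction N
  log_equiv : ∃ u₀ c C : ℝ, 0 < u₀ ∧ 0 < c ∧ 0 < C ∧
    ∀ u, u₀ < u → c * u ^ r ≤ Real.log (N u) ∧ Real.log (N u) ≤ C * u ^ r

/-- The continuous embedding `L_M ⊂ X`. -/
def OrliczEmbeds (M : ℝ → ℝ) (X : SymmetricSpace) : Prop :=
  ∃ C : ℝ, 0 < C ∧ ∀ x : L0, MemOrlicz M x →
    ∃ hx : x ∈ X.carrier, ‖(⟨x, hx⟩ : X.carrier)‖ ≤ C * orliczNorm M x

/-- The Rademacher functions `r_j(t) = (-1)^{[2^j t]}`, `j = 1, 2, …`. -/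
def rademacher (j : ℕ) (t : I) : ℝ := (-1 : ℝ) ^ ⌊(2 : ℝ) ^ j * (t : ℝ)⌋

theorem measurable_rademacher (j : ℕ) : Measurable (rademacher j) := by
  have h : Measurable fun t : I => ⌊(2 : ℝ) ^ j * (t : ℝ)⌋ :=
    Int.measurable_floor.comp (measurable_subtype_coe.const_mul _)
  exact (measurable_from_top (f := fun n : ℤ => (-1 : ℝ) ^ n)).comp h

/-- The set `△^d = {(j_1, …, j_d) ∈ ℕ^d : j_1 > j_2 > … > j_d}` of multi-indices with positive
integer entries, ordered lexicographically. -/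
abbrev Triangle (d : ℕ) : Type := {j : Lex (Fin d → ℕ+) // StrictAnti (ofLex j)}

/-- The Rademacher chaos `𝐫_j(t) = r_{j_1}(t) ⋯ r_{j_d}(t)`, `j ∈ △^d`. -/
def chaos {d : ℕ} (j : Triangle d) : L0 :=
  AEEqFun.mk (fun t : I => ∏ i : Fin d, rademacher (ofLex j.1 i : ℕ) t)
    (Finset.measurable_fun_prod _
      fun i _ => measurable_rademacher (ofLex j.1 i : ℕ)).aestronglyMeasurable

section Banach

variable {E : Type*} [NormedAddCommGroup E] [NormedSpace ℝ E]

/-- A sequence is basic if it is a (Schauder) basis of its closed linear span. -/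
def IsBasicSequence (x : ℕ → E) : Prop :=
  ∃ b : SchauderBasis ℝ (Submodule.span ℝ (range x)).topologicalClosure, ∀ k, (b k : E) = x k

/-- The estimate in the definition of `D`-RUC systems. The term `x k` (with `k` counted from `0`)
is paired with the Rademacher function `r_{k+1}`. -/
def RUCEstimate (D : ℝ) (x : ℕ → E) : Prop :=
  ∀ (n : ℕ) (a : ℕ → ℝ),
    ∫ u : I, ‖∑ k ∈ Finset.range n, (rademacher (k + 1) u * a k) • x k‖ ≤
      D * ‖∑ k ∈ Finset.range n, a k • x k‖

/-- RUC sequences (systems of random unconditional convergence). -/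
def IsRUCSequence (x : ℕ → E) : Prop :=
  IsBasicSequence x ∧ ∃ D : ℝ, 0 < D ∧ RUCEstimate D x

end Banach

end

/-! A function of `r_1, …, r_n` is a function on the discrete cube, encoded by finite sets `B` with
`symmDiff` as group law. The norm of `X` restricted to such functions is a lattice norm invariant
under translations of this group. Everything follows from averaging over translations and from
comparing both sides of the RUC estimate with `‖a‖₂`.

Lower bound: the average of all translates of `|P|` is the constant `‖P‖₁`, so `‖P‖_X ≥ ‖P‖₁ ‖1‖_X`
(`cubeMean_abs_mul_norm_le`). Bonami's fourth moment inequality gives `‖a‖₂ ≤ 3^d ‖P‖₁` for a chaos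
polynomial `P` of order `d` with coefficients `a` (`le_cubeMean_abs_walshSum`).

Upper bound: with `t` fixed, the randomized sum is a Rademacher sum in `u` whose coefficients have
`ℓ²` norm `‖a‖₂`, hence it is exponentially square integrable in `u` (`cubeMean_exp_sq_le`). By
Fubini its Orlicz modular in `t`, at a scale proportional to `‖a‖₂`, has bounded mean in `u`;
convexity of `N` turns this into a bound for the mean norm. Neither bound sees the enumeration.

Basic sequence: the multi-indices lexicographically below `q` split into `d` classes by the position
`i` of the first difference from `q`. Membership in a class depends only on the trace of the support
on `[q_i, ∞)`, so the corresponding projection is an average over sign changes and has norm at most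
one (`norm_cubeToSpace_sum_filter_le`). Initial partial sums are thus bounded with constant `d`, and
Grünblum's criterion applies. -/

/-! ### Walsh functions on finite subsets of `ℕ` -/

/-- The sign `-1` if `k ∈ B` and `1` otherwise: the `k`-th coordinate of the point of the discrete
cube that is encoded by `B`. -/
noncomputable def coordSign (k : ℕ) (B : Finset ℕ) : ℝ := if k ∈ B then -1 else 1

/-- The Walsh function `w_A(B) = (-1)^{|A ∩ B|}`. -/
noncomputable def walsh (A B : Finset ℕ) : ℝ := ∏ k ∈ A, coordSign k B

/-- The mean of a function over the subsets of `S`. -/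
noncomputable def cubeMean (S : Finset ℕ) (f : Finset ℕ → ℝ) : ℝ :=
  (∑ B ∈ S.powerset, f B) / 2 ^ S.card

theorem coordSign_mul_self (k : ℕ) (B : Finset ℕ) : coordSign k B * coordSign k B = 1 := by
  unfold coordSign; split_ifs <;> norm_num

theorem abs_coordSign (k : ℕ) (B : Finset ℕ) : |coordSign k B| = 1 := by
  unfold coordSign; split_ifs <;> norm_num

theorem coordSign_symmDiff (k : ℕ) (B C : Finset ℕ) :
    coordSign k (symmDiff B C) = coordSign k B * coordSign k C := by
  unfold coordSign
  by_cases h1 : k ∈ B <;> by_cases h2 : k ∈ C <;> simp [Finset.mem_symmDiff, h1, h2]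

theorem walsh_symmDiff (A B C : Finset ℕ) :
    walsh A (symmDiff B C) = walsh A B * walsh A C := by
  simp [walsh, coordSign_symmDiff, Finset.prod_mul_distrib]

theorem abs_walsh (A B : Finset ℕ) : |walsh A B| = 1 := by
  simp [walsh, Finset.abs_prod, abs_coordSign]

theorem walsh_eq_neg_one_pow (A B : Finset ℕ) : walsh A B = (-1) ^ (A ∩ B).card := by
  simp only [walsh, coordSign]
  rw [Finset.prod_ite_mem, Finset.prod_const]

theorem walsh_comm (A B : Finset ℕ) : walsh A B = walsh B A := by
  rw [walsh_eq_neg_one_pow, walsh_eq_neg_one_pow, Finset.inter_comm]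

theorem walsh_empty (B : Finset ℕ) : walsh ∅ B = 1 := by simp [walsh]

/-- By the symmetry `walsh_comm` the sum factors over the coordinates `k ∈ S`. The factor at `k` is
`2` if `A` and `T` agree there and `0` otherwise, so only the traces on `S` matter. -/
theorem sum_walsh_mul_walsh (S A T : Finset ℕ) :
    ∑ C ∈ S.powerset, walsh T C * walsh A C = if A ∩ S = T ∩ S then 2 ^ S.card else 0 := by
  have h : ∑ C ∈ S.powerset, walsh T C * walsh A C
      = ∏ k ∈ S, (1 + coordSign k T * coordSign k A) := by
    rw [Finset.prod_one_add]
    refine Finset.sum_congr rfl fun C _ => ?_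
    rw [walsh_comm T, walsh_comm A, walsh, walsh, Finset.prod_mul_distrib]
  rw [h]
  split_ifs with hAT
  · rw [Finset.prod_congr rfl (g := fun _ => (2 : ℝ))]
    · simp
    · intro k hk
      have : k ∈ A ↔ k ∈ T := by
        have := Finset.ext_iff.1 hAT k
        simpa [hk] using this
      have h2 : coordSign k T = coordSign k A := by simp [coordSign, this]
      rw [h2, coordSign_mul_self]; norm_num
  · obtain ⟨k, hk⟩ : ∃ k, ¬ (k ∈ A ∩ S ↔ k ∈ T ∩ S) := by
      by_contra! hcon
      exact hAT (Finset.ext hcon)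
    simp only [Finset.mem_inter] at hk
    have hkS : k ∈ S := by tauto
    refine Finset.prod_eq_zero hkS ?_
    unfold coordSign
    by_cases h1 : k ∈ A <;> by_cases h2 : k ∈ T <;> simp_all

theorem sum_powerset_symmDiff {M : Type*} [AddCommMonoid M] {S C : Finset ℕ} (hC : C ⊆ S)
    (G : Finset ℕ → M) :
    ∑ B ∈ S.powerset, G (symmDiff B C) = ∑ B ∈ S.powerset, G B := by
  have hmem : ∀ B ∈ S.powerset, symmDiff B C ∈ S.powerset := by
    intro B hB
    rw [Finset.mem_powerset] at *
    intro k hk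
    rcases Finset.mem_symmDiff.1 hk with h | h
    · exact hB h.1
    · exact hC h.1
  refine Finset.sum_bij' (fun B _ => symmDiff B C) (fun B _ => symmDiff B C) hmem hmem ?_ ?_ ?_
  · intro B _; exact symmDiff_symmDiff_cancel_right C B
  · intro B _; exact symmDiff_symmDiff_cancel_right C B
  · intro B _; rfl

/-! ### Means over the cube -/

theorem cubeMean_empty (f : Finset ℕ → ℝ) : cubeMean ∅ f = f ∅ := by simp [cubeMean]

theorem cubeMean_add (S : Finset ℕ) (f g : Finset ℕ → ℝ) :
    cubeMean S (fun B => f B + g B) = cubeMean S f + cubeMean S g := by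
  simp [cubeMean, Finset.sum_add_distrib, add_div]

theorem cubeMean_const_mul (S : Finset ℕ) (c : ℝ) (f : Finset ℕ → ℝ) :
    cubeMean S (fun B => c * f B) = c * cubeMean S f := by
  simp [cubeMean, ← Finset.mul_sum, mul_div_assoc]

theorem cubeMean_const (S : Finset ℕ) (c : ℝ) : cubeMean S (fun _ => c) = c := by
  simp [cubeMean]

theorem cubeMean_congr {S : Finset ℕ} {f g : Finset ℕ → ℝ} (h : ∀ B ⊆ S, f B = g B) :
    cubeMean S f = cubeMean S g := by
  unfold cubeMean
  rw [Finset.sum_congr rfl fun B hB => h B (Finset.mem_powerset.1 hB)]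

theorem cubeMean_mono {S : Finset ℕ} {f g : Finset ℕ → ℝ} (h : ∀ B ⊆ S, f B ≤ g B) :
    cubeMean S f ≤ cubeMean S g := by
  unfold cubeMean
  gcongr with B hB
  exact h B (Finset.mem_powerset.1 hB)

theorem cubeMean_nonneg {S : Finset ℕ} {f : Finset ℕ → ℝ} (h : ∀ B ⊆ S, 0 ≤ f B) :
    0 ≤ cubeMean S f := by
  rw [← cubeMean_const S 0]
  exact cubeMean_mono h

theorem cubeMean_sum {ι : Type*} (S : Finset ℕ) (s : Finset ι) (f : ι → Finset ℕ → ℝ) :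
    cubeMean S (fun B => ∑ i ∈ s, f i B) = ∑ i ∈ s, cubeMean S (f i) := by
  simp only [cubeMean]
  rw [Finset.sum_comm, Finset.sum_div]

theorem cubeMean_comm (S T : Finset ℕ) (f : Finset ℕ → Finset ℕ → ℝ) :
    cubeMean S (fun B => cubeMean T (f B)) = cubeMean T (fun C => cubeMean S fun B => f B C) := by
  simp only [cubeMean, ← Finset.sum_div]
  rw [Finset.sum_comm, div_right_comm]

theorem cubeMean_insert {S : Finset ℕ} {s : ℕ} (hs : s ∉ S) (f : Finset ℕ → ℝ) :
    cubeMean (insert s S) f = cubeMean S (fun B => (f B + f (insert s B)) / 2) := by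
  unfold cubeMean
  rw [Finset.sum_powerset_insert hs, Finset.card_insert_of_notMem hs, ← Finset.sum_div,
    Finset.sum_add_distrib, div_div, pow_succ, mul_comm (2 ^ S.card : ℝ) 2]

theorem cubeMean_walsh_mul_walsh (S A T : Finset ℕ) :
    cubeMean S (fun C => walsh T C * walsh A C) = if A ∩ S = T ∩ S then 1 else 0 := by
  rw [cubeMean, sum_walsh_mul_walsh]
  split_ifs <;> simp

theorem cubeMean_mul_sq_le (S : Finset ℕ) (f g : Finset ℕ → ℝ) :
    cubeMean S (fun B => f B * g B) ^ 2
      ≤ cubeMean S (fun B => f B ^ 2) * cubeMean S (fun B => g B ^ 2) := by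
  unfold cubeMean
  rw [div_pow, div_mul_div_comm, ← sq]
  gcongr
  exact Finset.sum_mul_sq_le_sq_mul_sq _ _ _

/-! ### Polynomials on the cube: Bonami's inequality and its consequences -/

theorem coordSign_insert_of_ne {k s : ℕ} (h : k ≠ s) (B : Finset ℕ) :
    coordSign k (insert s B) = coordSign k B := by
  simp [coordSign, h]

theorem walsh_insert_right {A B : Finset ℕ} {s : ℕ} (hA : s ∉ A) :
    walsh A (insert s B) = walsh A B :=
  Finset.prod_congr rfl fun k hk =>
    coordSign_insert_of_ne (fun h : k = s => hA (h ▸ hk)) B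

theorem walsh_insert_left {A B : Finset ℕ} {s : ℕ} (hA : s ∉ A) :
    walsh (insert s A) B = coordSign s B * walsh A B := by
  rw [walsh, Finset.prod_insert hA, walsh]

/-- The function on the cube with Walsh coefficients `c`, restricted to subsets of `S`. -/
noncomputable def walshSum (S : Finset ℕ) (c : Finset ℕ → ℝ) (B : Finset ℕ) : ℝ :=
  ∑ A ∈ S.powerset, c A * walsh A B

/-- The splitting `F = h + r_s g`, with `h` and `g` independent of `r_s`, drives the induction for
Bonami's inequality. -/
theorem walshSum_insert {S : Finset ℕ} {s : ℕ} (hs : s ∉ S) (c : Finset ℕ → ℝ)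
    (B : Finset ℕ) :
    walshSum (insert s S) c B
      = walshSum S c B + coordSign s B * walshSum S (fun A => c (insert s A)) B := by
  unfold walshSum
  rw [Finset.sum_powerset_insert hs, Finset.mul_sum]
  congr 1
  refine Finset.sum_congr rfl fun A hA => ?_
  rw [walsh_insert_left fun h => hs (Finset.mem_powerset.1 hA h)]
  ring

theorem walshSum_insert_right {S : Finset ℕ} {s : ℕ} (hs : s ∉ S) (c : Finset ℕ → ℝ)
    (B : Finset ℕ) : walshSum S c (insert s B) = walshSum S c B :=
  Finset.sum_congr rfl fun A hA => by
    rw [walsh_insert_right fun h => hs (Finset.mem_powerset.1 hA h)]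

theorem cubeMean_walshSum_sq (S : Finset ℕ) (c : Finset ℕ → ℝ) :
    cubeMean S (fun B => walshSum S c B ^ 2) = ∑ A ∈ S.powerset, c A ^ 2 := by
  have h : ∀ B, walshSum S c B ^ 2
      = ∑ A ∈ S.powerset, ∑ T ∈ S.powerset, c A * c T * (walsh T B * walsh A B) := by
    intro B
    rw [sq, walshSum, Finset.sum_mul_sum]
    refine Finset.sum_congr rfl fun A _ => Finset.sum_congr rfl fun T _ => by ring
  simp only [h]
  rw [cubeMean_sum]
  refine Finset.sum_congr rfl fun A hA => ?_
  rw [cubeMean_sum]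
  simp only [cubeMean_const_mul, cubeMean_walsh_mul_walsh]
  rw [Finset.sum_eq_single A]
  · simp [sq]
  · intro T hT hne
    rw [Finset.mem_powerset] at hA hT
    rw [Finset.inter_eq_left.2 hA, Finset.inter_eq_left.2 hT, if_neg hne.symm, mul_zero]
  · intro h; exact absurd hA h

/-- Bonami's hypercontractive inequality between the fourth and the second moment of a polynomial
of degree at most `d` on the discrete cube. -/
theorem cubeMean_walshSum_pow_four_le (S : Finset ℕ) :
    ∀ (d : ℕ) (c : Finset ℕ → ℝ), (∀ A ⊆ S, d < A.card → c A = 0) →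
      cubeMean S (fun B => walshSum S c B ^ 4) ≤ 9 ^ d * (∑ A ∈ S.powerset, c A ^ 2) ^ 2 := by
  induction S using Finset.induction_on with
  | empty =>
    intro d c _
    have h1 : (1 : ℝ) ≤ 9 ^ d := one_le_pow₀ (by norm_num)
    simp only [cubeMean_empty, walshSum, Finset.powerset_empty, Finset.sum_singleton, walsh_empty,
      mul_one]
    nlinarith [sq_nonneg (c ∅ ^ 2)]
  | insert s S hs ih =>
    intro d c hc
    have hcS : ∀ A ⊆ S, d < A.card → c A = 0 := fun A hA =>
      hc A (hA.trans (Finset.subset_insert s S))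
    set c' : Finset ℕ → ℝ := fun A => c (insert s A) with hc'
    set h : Finset ℕ → ℝ := walshSum S c with hh
    set g : Finset ℕ → ℝ := walshSum S c' with hg
    -- Averaging over the sign of coordinate `s` removes the odd powers of `g` from `(h ± g)^4`.
    have hsplit : cubeMean (insert s S) (fun B => walshSum (insert s S) c B ^ 4)
        = cubeMean S (fun B => h B ^ 4) + 6 * cubeMean S (fun B => g B ^ 2 * h B ^ 2)
          + cubeMean S (fun B => g B ^ 4) := by
      rw [cubeMean_insert hs, ← cubeMean_const_mul, ← cubeMean_add, ← cubeMean_add]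
      refine cubeMean_congr fun B hB => ?_
      have hsB : s ∉ B := fun h => hs (hB h)
      rw [walshSum_insert hs, walshSum_insert hs, walshSum_insert_right hs,
        walshSum_insert_right hs]
      simp only [coordSign, hsB, Finset.mem_insert_self, if_true, if_false]
      ring
    have hsum : ∑ A ∈ (insert s S).powerset, c A ^ 2
        = ∑ A ∈ S.powerset, c A ^ 2 + ∑ A ∈ S.powerset, c' A ^ 2 :=
      Finset.sum_powerset_insert hs _
    rw [hsplit, hsum]
    set H := ∑ A ∈ S.powerset, c A ^ 2
    set G := ∑ A ∈ S.powerset, c' A ^ 2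
    have hH0 : 0 ≤ H := Finset.sum_nonneg fun _ _ => sq_nonneg _
    have hG0 : 0 ≤ G := Finset.sum_nonneg fun _ _ => sq_nonneg _
    have h4 := ih d c hcS
    cases d with
    | zero =>
      have hz : ∀ A ∈ S.powerset, c' A = 0 := by
        intro A hA
        refine hc _ (Finset.insert_subset_insert s (Finset.mem_powerset.1 hA)) ?_
        exact Finset.card_pos.2 ⟨s, Finset.mem_insert_self s A⟩
      have hg0 : ∀ B, g B = 0 := fun B =>
        Finset.sum_eq_zero fun A hA => by rw [hz A hA, zero_mul]
      have hG : G = 0 := Finset.sum_eq_zero fun A hA => by rw [hz A hA]; norm_num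
      simp only [hg0, hG]
      norm_num [cubeMean_const]
      norm_num at h4
      exact h4
    | succ d =>
      -- Splitting off `r_s` lowers the degree of `g` by one, which saves a factor `9`.
      have g4 := ih d c' (by
        intro A hA hd
        refine hc _ (Finset.insert_subset_insert s hA) ?_
        rw [Finset.card_insert_of_notMem fun h => hs (hA h)]
        omega)
      have hcs := cubeMean_mul_sq_le S (fun B => g B ^ 2) (fun B => h B ^ 2)
      simp only [← pow_mul] at hcs
      norm_num at hcs
      have hh40 : 0 ≤ cubeMean S fun B => h B ^ 4 := cubeMean_nonneg fun B _ => by positivity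
      -- Cauchy–Schwarz bounds the mixed moment by `3 * 9 ^ d * G * H`. Its weight `6` then gives `2
      -- * 9 ^ (d + 1) * G * H`, exactly the cross term of `9 ^ (d + 1) * (H + G) ^ 2`.
      have hprod : cubeMean S (fun B => g B ^ 2 * h B ^ 2) ^ 2 ≤ (3 * 9 ^ d * (G * H)) ^ 2 := by
        refine hcs.trans ?_
        calc _ ≤ (9 ^ d * G ^ 2) * (9 ^ (d + 1) * H ^ 2) := by gcongr
          _ = _ := by ring
      have hgh := abs_le_of_sq_le_sq hprod (by positivity)
      have hgh' := (le_abs_self _).trans hgh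
      rw [pow_succ] at h4 ⊢
      have h9 : (0 : ℝ) ≤ 9 ^ d := by positivity
      nlinarith [mul_nonneg h9 (sq_nonneg G)]

/-- The second moment is interpolated between the first and the fourth, and the fourth is controlled
by Bonami's inequality. -/
theorem le_cubeMean_abs_walshSum (S : Finset ℕ) (d : ℕ) (c : Finset ℕ → ℝ)
    (hc : ∀ A ⊆ S, d < A.card → c A = 0) :
    √(∑ A ∈ S.powerset, c A ^ 2) ≤ 3 ^ d * cubeMean S (fun B => |walshSum S c B|) := by
  set V := ∑ A ∈ S.powerset, c A ^ 2 with hV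
  have hV0 : 0 ≤ V := Finset.sum_nonneg fun _ _ => sq_nonneg _
  have h4 := cubeMean_walshSum_pow_four_le S d c hc
  have h2 := cubeMean_walshSum_sq S c
  rw [← hV] at h4 h2
  have h10 : 0 ≤ cubeMean S (fun B => |walshSum S c B|) :=
    cubeMean_nonneg fun B _ => abs_nonneg _
  rcases hV0.eq_or_lt with h | hpos
  · rw [← h, Real.sqrt_zero]; positivity
  set v := √V with hv
  have hvpos : 0 < v := Real.sqrt_pos.2 hpos
  have hvV : V = v ^ 2 := (Real.sq_sqrt hV0).symm
  set q : ℝ := 3 ^ d with hq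
  have hqpos : 0 < q := by positivity
  have hq9 : (9 : ℝ) ^ d = q ^ 2 := by rw [hq, ← pow_mul, mul_comm, pow_mul]; norm_num
  set s := q * v with hs
  have hspos : 0 < s := by positivity
  -- This is `x (x - s)² (x + 2s) ≥ 0` with `x = |F|`. The scale `s = 3^d v` makes the bound on the
  -- fourth moment equal to `s² v²`, which leaves `2 s² v²` on the left.
  have hpt : cubeMean S (fun B => 3 * s ^ 2 * walshSum S c B ^ 2)
      ≤ cubeMean S (fun B => 2 * s ^ 3 * |walshSum S c B| + walshSum S c B ^ 4) := by
    refine cubeMean_mono fun B _ => ?_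
    set x := |walshSum S c B| with hx
    have hx0 : 0 ≤ x := abs_nonneg _
    have e2 : walshSum S c B ^ 2 = x ^ 2 := (sq_abs _).symm
    have e4 : walshSum S c B ^ 4 = x ^ 4 := by
      rw [show 4 = 2 * 2 from rfl, pow_mul, e2, ← pow_mul]
    rw [e2, e4]
    have : 0 ≤ x * (x - s) ^ 2 * (x + 2 * s) := by positivity
    nlinarith [this]
  rw [cubeMean_add, cubeMean_const_mul, cubeMean_const_mul, h2] at hpt
  rw [hq9, hvV] at h4
  rw [hvV] at hpt
  set E := cubeMean S (fun B => |walshSum S c B|)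
  have key : 2 * s ^ 3 * v ≤ 2 * s ^ 3 * (q * E) := by
    have e : 3 * s ^ 2 * v ^ 2 - q ^ 2 * (v ^ 2) ^ 2 = 2 * s ^ 2 * v ^ 2 := by rw [hs]; ring
    have : 2 * s ^ 2 * v ^ 2 ≤ 2 * s ^ 3 * E := by linarith
    calc 2 * s ^ 3 * v = q * (2 * s ^ 2 * v ^ 2) := by rw [hs]; ring
      _ ≤ q * (2 * s ^ 3 * E) := by gcongr
      _ = _ := by ring
  exact le_of_mul_le_mul_left key (by positivity)

/-! ### Exponential square integrability of Rademacher sums -/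

/-- Averaging over one sign and using `cosh y ≤ exp (y² / 2)` replaces `l` by `l (1 + 2 l b²)`. The
growth factor is at most `exp (b²)`, so the smallness condition passes to the remaining coordinates.
Since `l` changes, it is quantified inside the induction. -/
theorem cubeMean_exp_sq_le (S : Finset ℕ) (b : ℕ → ℝ) :
    ∀ l : ℝ, 0 ≤ l → l * Real.exp (∑ k ∈ S, b k ^ 2) ≤ 1 / 2 →
      cubeMean S (fun B => Real.exp (l * (∑ k ∈ S, coordSign k B * b k) ^ 2))
        ≤ Real.exp ((∑ k ∈ S, b k ^ 2) / 2) := by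
  induction S using Finset.induction_on with
  | empty => intro l _ _; simp [cubeMean_empty]
  | insert s S hs ih =>
    intro l hl hle
    rw [Finset.sum_insert hs] at hle ⊢
    set V := ∑ k ∈ S, b k ^ 2 with hV
    have hV0 : 0 ≤ V := Finset.sum_nonneg fun _ _ => sq_nonneg _
    have hlhalf : l ≤ 1 / 2 := by
      refine le_trans ?_ hle
      exact le_mul_of_one_le_right hl (Real.one_le_exp (by positivity))
    set l' := l * (1 + 2 * l * b s ^ 2) with hl'
    have h1 : 1 + 2 * l * b s ^ 2 ≤ Real.exp (b s ^ 2) := by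
      have := Real.add_one_le_exp (b s ^ 2)
      nlinarith [sq_nonneg (b s)]
    have hih := ih l' (by positivity) (by
      refine le_trans ?_ hle
      rw [hl', Real.exp_add, ← mul_assoc]
      gcongr)
    have hstep : cubeMean (insert s S)
          (fun B => Real.exp (l * (∑ k ∈ insert s S, coordSign k B * b k) ^ 2))
        ≤ cubeMean S (fun B => Real.exp (b s ^ 2 / 2) *
            Real.exp (l' * (∑ k ∈ S, coordSign k B * b k) ^ 2)) := by
      rw [cubeMean_insert hs]
      refine cubeMean_mono fun B hB => ?_
      have hsB : s ∉ B := fun h => hs (hB h)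
      have hins : ∑ k ∈ S, coordSign k (insert s B) * b k = ∑ k ∈ S, coordSign k B * b k :=
        Finset.sum_congr rfl fun k hk => by
          rw [coordSign_insert_of_ne fun h : k = s => hs (h ▸ hk)]
      rw [Finset.sum_insert hs, Finset.sum_insert hs, hins]
      set x := ∑ k ∈ S, coordSign k B * b k
      have c1 : coordSign s B = 1 := by simp [coordSign, hsB]
      have c2 : coordSign s (insert s B) = -1 := by simp [coordSign]
      rw [c1, c2]
      set y := 2 * l * x * b s with hy
      have e1 : Real.exp (l * (1 * b s + x) ^ 2)
          = Real.exp (l * x ^ 2 + l * b s ^ 2) * Real.exp y := by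
        rw [← Real.exp_add]; congr 1; rw [hy]; ring
      have e2 : Real.exp (l * (-1 * b s + x) ^ 2)
          = Real.exp (l * x ^ 2 + l * b s ^ 2) * Real.exp (-y) := by
        rw [← Real.exp_add]; congr 1; rw [hy]; ring
      rw [e1, e2, ← mul_add, mul_div_assoc, ← Real.cosh_eq]
      calc _ ≤ Real.exp (l * x ^ 2 + l * b s ^ 2) * Real.exp (y ^ 2 / 2) := by
            gcongr; exact Real.cosh_le_exp_half_sq y
        _ = Real.exp (l * b s ^ 2 + l' * x ^ 2) := by
            rw [← Real.exp_add]; congr 1; rw [hy, hl']; ring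
        _ ≤ Real.exp (b s ^ 2 / 2 + l' * x ^ 2) := by
            apply Real.exp_le_exp.2
            nlinarith [sq_nonneg (b s)]
        _ = _ := by rw [Real.exp_add]
    refine hstep.trans ?_
    rw [cubeMean_const_mul, add_div, Real.exp_add]
    gcongr

/-! ### The joint law of the Rademacher functions -/

/-- The set of `k < n` with `r_{k+1}(t) = -1`. -/
noncomputable def rademacherBits (n : ℕ) (t : I) : Finset ℕ :=
  (Finset.range n).filter fun k => Odd ⌊(2 : ℝ) ^ (k + 1) * (t : ℝ)⌋

theorem mem_rademacherBits {n k : ℕ} {t : I} :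
    k ∈ rademacherBits n t ↔ k < n ∧ Odd ⌊(2 : ℝ) ^ (k + 1) * (t : ℝ)⌋ := by
  simp [rademacherBits]

theorem rademacherBits_subset (n : ℕ) (t : I) : rademacherBits n t ⊆ Finset.range n :=
  Finset.filter_subset _ _

theorem rademacher_succ {n k : ℕ} (hk : k < n) (t : I) :
    rademacher (k + 1) t = coordSign k (rademacherBits n t) := by
  unfold rademacher coordSign
  simp only [mem_rademacherBits, hk, true_and]
  split_ifs with h
  · exact h.neg_one_zpow
  · exact (Int.not_odd_iff_even.1 h).neg_one_zpow

theorem measurable_rademacherBits (n : ℕ) : Measurable (rademacherBits n) := by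
  refine measurable_finset_iff.2 fun k => ?_
  have h : Measurable fun t : I => ⌊(2 : ℝ) ^ (k + 1) * (t : ℝ)⌋ :=
    Int.measurable_floor.comp (measurable_subtype_coe.const_mul _)
  have : (fun t => k ∈ rademacherBits n t)
      = (fun z : ℤ => k < n ∧ Odd z) ∘ fun t : I => ⌊(2 : ℝ) ^ (k + 1) * (t : ℝ)⌋ := by
    funext t; simp [mem_rademacherBits]
  rw [this]
  exact Measurable.of_discrete.comp h

/-- The parities are binary digits: `⌊2x⌋` is `2⌊x⌋` or `2⌊x⌋ + 1`, so the floors are recovered one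
digit at a time from `⌊x⌋ = 0`. The endpoint `1` is excluded because its floor is `1`. -/
theorem floor_eq_of_rademacherBits_eq {n : ℕ} {s t : I} (hs : (s : ℝ) < 1) (ht : (t : ℝ) < 1)
    (h : rademacherBits n s = rademacherBits n t) :
    ∀ j ≤ n, ⌊(2 : ℝ) ^ j * (s : ℝ)⌋ = ⌊(2 : ℝ) ^ j * (t : ℝ)⌋ := by
  have hdouble : ∀ x : ℝ, 2 * ⌊x⌋ ≤ ⌊2 * x⌋ ∧ ⌊2 * x⌋ ≤ 2 * ⌊x⌋ + 1 := by
    intro x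
    have h1 := Int.floor_le x
    have h2 := Int.lt_floor_add_one x
    constructor
    · rw [Int.le_floor]; push_cast; linarith
    · rw [← Int.lt_add_one_iff, Int.floor_lt]; push_cast; linarith
  intro j
  induction j with
  | zero =>
    intro _
    have e : ∀ u : I, (u : ℝ) < 1 → ⌊(u : ℝ)⌋ = 0 := fun u hu =>
      Int.floor_eq_zero_iff.2 ⟨u.2.1, hu⟩
    simp [e s hs, e t ht]
  | succ j ih =>
    intro hj
    have hodd := Finset.ext_iff.1 h j
    have hjn : j < n := hj
    simp only [mem_rademacherBits, hjn, true_and] at hodd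
    have ih := ih (by omega)
    have es := hdouble ((2 : ℝ) ^ j * s)
    have et := hdouble ((2 : ℝ) ^ j * t)
    rw [← mul_assoc, ← pow_succ'] at es et
    rw [Int.odd_iff, Int.odd_iff] at hodd
    omega

theorem volume_rademacherBits_preimage_le (n : ℕ) (B : Finset ℕ) :
    volume (rademacherBits n ⁻¹' {B}) ≤ ENNReal.ofReal (1 / 2 ^ n) := by
  by_cases hne : ∃ s : I, (s : ℝ) < 1 ∧ rademacherBits n s = B
  · obtain ⟨s, hs, hsB⟩ := hne
    set m := ⌊(2 : ℝ) ^ n * (s : ℝ)⌋ with hm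
    have hsub : rademacherBits n ⁻¹' {B} ⊆
        {1} ∪ (Subtype.val ⁻¹' Ico ((m : ℝ) / 2 ^ n) (((m : ℝ) + 1) / 2 ^ n) : Set I) := by
      intro t ht
      rcases t.2.2.eq_or_lt with h1 | h1
      · left; exact Subtype.ext h1
      · right
        have hfl := floor_eq_of_rademacherBits_eq hs h1 (hsB.trans (Eq.symm ht)) n le_rfl
        rw [← hm, eq_comm, Int.floor_eq_iff] at hfl
        rw [mem_preimage, mem_Ico, div_le_iff₀ (by positivity), lt_div_iff₀ (by positivity),
          mul_comm (t : ℝ)]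
        exact hfl
    refine (measure_mono hsub).trans ((measure_union_le _ _).trans ?_)
    rw [measure_singleton, zero_add, unitInterval.volume_apply]
    refine (measure_mono (image_preimage_subset _ _)).trans ?_
    rw [Real.volume_Ico]
    apply le_of_eq
    congr 1
    ring
  · have hsub : rademacherBits n ⁻¹' {B} ⊆ {1} := by
      intro t ht
      rcases t.2.2.eq_or_lt with h1 | h1
      · exact Subtype.ext h1
      · exact absurd ⟨t, h1, ht⟩ hne
    refine (measure_mono hsub).trans ?_
    simp

theorem lintegral_rademacherBits_eq_sum (n : ℕ) (G : Finset ℕ → ENNReal) :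
    ∫⁻ t, G (rademacherBits n t)
      = ∑ B ∈ (Finset.range n).powerset, G B * volume (rademacherBits n ⁻¹' {B}) := by
  have hm := measurable_rademacherBits n
  have h0 : ∫⁻ t, G (rademacherBits n t)
      = ∫⁻ B, G B ∂(Measure.map (rademacherBits n) volume) :=
    (lintegral_map Measurable.of_discrete hm).symm
  rw [h0, lintegral_countable']
  simp_rw [Measure.map_apply hm (measurableSet_singleton _)]
  refine tsum_eq_sum fun B hB => ?_
  have : rademacherBits n ⁻¹' {B} = ∅ := by
    refine eq_empty_of_forall_notMem fun t ht => hB ?_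
    rw [← show rademacherBits n t = B from ht, Finset.mem_powerset]
    exact rademacherBits_subset n t
  rw [this]; simp

/-- The upper bound suffices: `2^n` sets of measure at most `2^{-n}` have total measure `1`, so
every bound is an equality. -/
theorem volume_rademacherBits_preimage {n : ℕ} {B : Finset ℕ} (hB : B ⊆ Finset.range n) :
    volume (rademacherBits n ⁻¹' {B}) = ENNReal.ofReal (1 / 2 ^ n) := by
  have hsum := lintegral_rademacherBits_eq_sum n 1
  simp only [Pi.one_apply, lintegral_const, measure_univ, one_mul] at hsum
  have hreal : ∑ B ∈ (Finset.range n).powerset, volume.real (rademacherBits n ⁻¹' {B})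
      = ∑ B ∈ (Finset.range n).powerset, (1 / 2 ^ n : ℝ) := by
    simp only [measureReal_def]
    rw [← ENNReal.toReal_sum fun _ _ => measure_ne_top _ _, ← hsum]
    simp
  have hle : ∀ B ∈ (Finset.range n).powerset,
      volume.real (rademacherBits n ⁻¹' {B}) ≤ (1 / 2 ^ n : ℝ) := fun B _ =>
    ENNReal.toReal_le_of_le_ofReal (by positivity) (volume_rademacherBits_preimage_le n B)
  have := (Finset.sum_eq_sum_iff_of_le hle).1 hreal B (Finset.mem_powerset.2 hB)
  rw [← this, measureReal_def, ENNReal.ofReal_toReal (measure_ne_top _ _)]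

/-- The Rademacher functions `r_1, …, r_n` are independent and symmetric. -/
theorem lintegral_rademacherBits (n : ℕ) (G : Finset ℕ → ENNReal) :
    ∫⁻ t, G (rademacherBits n t)
      = (∑ B ∈ (Finset.range n).powerset, G B) * ENNReal.ofReal (1 / 2 ^ n) := by
  rw [lintegral_rademacherBits_eq_sum, Finset.sum_mul]
  refine Finset.sum_congr rfl fun B hB => ?_
  rw [volume_rademacherBits_preimage (Finset.mem_powerset.1 hB)]

theorem lintegral_rademacherBits_ofReal (n : ℕ) {f : Finset ℕ → ℝ} (hf : ∀ B, 0 ≤ f B) :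
    ∫⁻ t, ENNReal.ofReal (f (rademacherBits n t))
      = ENNReal.ofReal (cubeMean (Finset.range n) f) := by
  rw [lintegral_rademacherBits n fun B => ENNReal.ofReal (f B), cubeMean,
    ← ENNReal.ofReal_sum_of_nonneg fun B _ => hf B,
    ← ENNReal.ofReal_mul (Finset.sum_nonneg fun B _ => hf B), Finset.card_range, mul_one_div]

theorem integral_rademacherBits (n : ℕ) {f : Finset ℕ → ℝ} (hf : ∀ B, 0 ≤ f B) :
    ∫ t, f (rademacherBits n t) = cubeMean (Finset.range n) f := by
  rw [integral_eq_lintegral_of_nonneg_ae (Eventually.of_forall fun t => hf _),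
    lintegral_rademacherBits_ofReal n hf, ENNReal.toReal_ofReal]
  · exact cubeMean_nonneg fun B _ => hf B
  · exact (Measurable.of_discrete.comp (measurable_rademacherBits n)).aestronglyMeasurable

/-! ### Functions of finitely many Rademacher functions -/

theorem aestronglyMeasurable_comp_rademacherBits (n : ℕ) (F : Finset ℕ → ℝ) :
    AEStronglyMeasurable (fun t => F (rademacherBits n t)) (volume : Measure I) :=
  (Measurable.of_discrete.comp (measurable_rademacherBits n)).aestronglyMeasurable

/-- The element of `L0` given by a function of the first `n` Rademacher functions. -/
noncomputable def cubeToL0 (n : ℕ) : (Finset ℕ → ℝ) →ₗ[ℝ] L0 where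
  toFun F := AEEqFun.mk (fun t => F (rademacherBits n t))
    (aestronglyMeasurable_comp_rademacherBits n F)
  map_add' _ _ := rfl
  map_smul' _ _ := rfl

theorem coeFn_cubeToL0 (n : ℕ) (F : Finset ℕ → ℝ) :
    cubeToL0 n F =ᵐ[volume] fun t => F (rademacherBits n t) :=
  AEEqFun.coeFn_mk _ _

theorem cubeToL0_congr {n : ℕ} {F G : Finset ℕ → ℝ} (h : ∀ B ⊆ Finset.range n, F B = G B) :
    cubeToL0 n F = cubeToL0 n G := by
  refine AEEqFun.mk_eq_mk.2 (Eventually.of_forall fun t => ?_)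
  exact h _ (rademacherBits_subset n t)

theorem abs_cubeToL0_le {n : ℕ} {F G : Finset ℕ → ℝ}
    (h : ∀ B ⊆ Finset.range n, |F B| ≤ |G B|) : |cubeToL0 n F| ≤ |cubeToL0 n G| := by
  rw [← AEEqFun.coeFn_le]
  filter_upwards [AEEqFun.coeFn_abs (cubeToL0 n F), AEEqFun.coeFn_abs (cubeToL0 n G),
    coeFn_cubeToL0 n F, coeFn_cubeToL0 n G] with t h1 h2 h3 h4
  rw [h1, h2, h3, h4]
  exact h _ (rademacherBits_subset n t)

theorem distribution_abs_cubeToL0 (n : ℕ) (F : Finset ℕ → ℝ) (τ : ℝ) :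
    distribution |cubeToL0 n F| τ
      = (∑ B ∈ (Finset.range n).powerset, if τ < |F B| then 1 else 0)
        * ENNReal.ofReal (1 / 2 ^ n) := by
  classical
  rw [← lintegral_rademacherBits n fun B => if τ < |F B| then 1 else 0, distribution]
  have hset : {t : I | τ < |cubeToL0 n F| t} =ᵐ[volume]
      (rademacherBits n ⁻¹' {B | τ < |F B|} : Set I) := by
    filter_upwards [AEEqFun.coeFn_abs (cubeToL0 n F), coeFn_cubeToL0 n F] with t h1 h2
    change (τ < |cubeToL0 n F| t) = (τ < |F (rademacherBits n t)|)
    rw [h1, h2]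
  have hmeas : MeasurableSet (rademacherBits n ⁻¹' {B | τ < |F B|}) :=
    measurable_rademacherBits n (MeasurableSet.of_discrete)
  rw [measure_congr hset, ← lintegral_indicator_one hmeas]
  refine lintegral_congr fun t => ?_
  simp [indicator_apply]

/-- The distribution function only counts values on the cube, and a translation permutes the points
of the cube. -/
theorem rearrangement_cubeToL0_symmDiff {n : ℕ} (F : Finset ℕ → ℝ) {C : Finset ℕ}
    (hC : C ⊆ Finset.range n) (t : ℝ) :
    rearrangement (cubeToL0 n fun B => F (symmDiff B C)) t = rearrangement (cubeToL0 n F) t := by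
  unfold rearrangement
  congr 1
  ext τ
  rw [mem_ofPred_eq, mem_ofPred_eq, distribution_abs_cubeToL0, distribution_abs_cubeToL0,
    sum_powerset_symmDiff hC fun B => if τ < |F B| then (1 : ENNReal) else 0]

theorem orliczModular_cubeToL0 {N : ℝ → ℝ} (hN : ∀ u, 0 ≤ u → 0 ≤ N u) (n : ℕ)
    (F : Finset ℕ → ℝ) {c : ℝ} (hc : 0 < c) :
    orliczModular N (cubeToL0 n F) c
      = ENNReal.ofReal (cubeMean (Finset.range n) fun B => N (|F B| / c)) := by
  rw [← lintegral_rademacherBits_ofReal n fun B => hN _ (by positivity)]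
  refine lintegral_congr_ae ?_
  filter_upwards [coeFn_cubeToL0 n F] with t h
  rw [h]

theorem orliczNorm_le {N : ℝ → ℝ} {x : L0} {c : ℝ} (hc : 0 < c) (h : orliczModular N x c ≤ 1) :
    orliczNorm N x ≤ c :=
  csInf_le ⟨0, fun _ h => h.1.le⟩ ⟨hc, h⟩

theorem memOrlicz_cubeToL0 {N : ℝ → ℝ} (hN : ∀ u, 0 ≤ u → 0 ≤ N u) (n : ℕ)
    (F : Finset ℕ → ℝ) : MemOrlicz N (cubeToL0 n F) :=
  ⟨1, one_pos, by rw [orliczModular_cubeToL0 hN n F one_pos]; exact ENNReal.ofReal_lt_top⟩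

theorem IsOrliczFunction.map_div_le {N : ℝ → ℝ} (hN : IsOrliczFunction N) {x a : ℝ} (hx : 0 ≤ x)
    (ha : 1 ≤ a) : N (x / a) ≤ N x / a := by
  have hapos : 0 < a := by linarith
  have := hN.convex.2 (mem_Ici.2 hx) (mem_Ici.2 le_rfl)
    (show 0 ≤ a⁻¹ by positivity)
    (show 0 ≤ 1 - a⁻¹ by linarith [inv_le_one_of_one_le₀ ha]) (by ring)
  simp only [smul_eq_mul, mul_zero, add_zero, hN.map_zero] at this
  rwa [inv_mul_eq_div, inv_mul_eq_div] at this

/-- The Orlicz norm is at most `c (1 + m)`, where `m` is the modular at scale `c`. -/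
theorem orliczNorm_cubeToL0_le {N : ℝ → ℝ} (hN : IsOrliczFunction N) (n : ℕ)
    (F : Finset ℕ → ℝ) {c : ℝ} (hc : 0 < c) :
    orliczNorm N (cubeToL0 n F)
      ≤ c * (1 + cubeMean (Finset.range n) fun B => N (|F B| / c)) := by
  set m := cubeMean (Finset.range n) fun B => N (|F B| / c) with hm
  have hm0 : 0 ≤ m := cubeMean_nonneg fun B _ => hN.nonneg _ (by positivity)
  refine orliczNorm_le (by positivity) ?_
  rw [orliczModular_cubeToL0 hN.nonneg n F (by positivity), ENNReal.ofReal_le_one]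
  calc cubeMean (Finset.range n) (fun B => N (|F B| / (c * (1 + m))))
      ≤ cubeMean (Finset.range n) (fun B => (1 + m)⁻¹ * N (|F B| / c)) := by
        refine cubeMean_mono fun B _ => ?_
        rw [← div_div, inv_mul_eq_div]
        exact hN.map_div_le (by positivity) (by linarith)
    _ = (1 + m)⁻¹ * m := cubeMean_const_mul _ _ _
    _ ≤ 1 := by rw [inv_mul_le_iff₀ (by positivity)]; linarith

/-- Beyond `u₀` the logarithmic bound applies. Below it `N` is at most its value at `u₀ + 1`, by
convexity and `N 0 = 0`; the constant `K` absorbs this value. -/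
theorem GeneratesExpL.exists_le_exp_sq {N : ℝ → ℝ} (hN : GeneratesExpL 2 N) :
    ∃ C K : ℝ, 0 < C ∧ 0 < K ∧ ∀ u, 0 ≤ u → N u ≤ K * Real.exp (C * u ^ 2) := by
  obtain ⟨u₀, c, C, hu₀, hc, hC, hlog⟩ := hN.log_equiv
  have hlarge : ∀ u, u₀ < u → N u ≤ Real.exp (C * u ^ 2) := by
    intro u hu
    have h0 := hN.orlicz.nonneg u (by linarith)
    rcases h0.eq_or_lt with h | h
    · rw [← h]; positivity
    · rw [← Real.log_le_iff_le_exp h]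
      simpa using (hlog u hu).2
  have hu1 : 0 < u₀ + 1 := by linarith
  have hN1 : 0 ≤ N (u₀ + 1) := hN.orlicz.nonneg _ hu1.le
  refine ⟨C, 1 + N (u₀ + 1), hC, by linarith, fun u hu => ?_⟩
  have hexp : 1 ≤ Real.exp (C * u ^ 2) := Real.one_le_exp (by positivity)
  rcases le_or_gt u u₀ with h | h
  · have hle : N u ≤ N (u₀ + 1) := by
      rcases hu.eq_or_lt with h0 | h0
      · rw [← h0, hN.orlicz.map_zero]; exact hN1
      · have ha : 1 ≤ (u₀ + 1) / u := by rw [le_div_iff₀ h0]; linarith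
        have := hN.orlicz.map_div_le hu1.le ha
        rw [div_div_cancel₀ hu1.ne'] at this
        exact this.trans (div_le_self hN1 ha)
    nlinarith
  · have := hlarge u h
    nlinarith

/-! ### The restriction of the norm of a symmetric space to the cube -/

section SymmetricNorm

variable {X : SymmetricSpace} {n : ℕ}

/-- The functions of the first `n` Rademacher functions as elements of a symmetric space. -/
noncomputable def cubeToSpace (h : ∀ n F, cubeToL0 n F ∈ X.carrier) (n : ℕ) :
    (Finset ℕ → ℝ) →ₗ[ℝ] X.carrier :=
  (cubeToL0 n).codRestrict X.carrier (h n)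

variable (h : ∀ n F, cubeToL0 n F ∈ X.carrier)

theorem cubeToSpace_congr {F G : Finset ℕ → ℝ} (hFG : ∀ B ⊆ Finset.range n, F B = G B) :
    cubeToSpace h n F = cubeToSpace h n G :=
  Subtype.ext (cubeToL0_congr hFG)

theorem norm_cubeToSpace_le_of_abs_le {F G : Finset ℕ → ℝ}
    (hFG : ∀ B ⊆ Finset.range n, |F B| ≤ |G B|) : ‖cubeToSpace h n F‖ ≤ ‖cubeToSpace h n G‖ := by
  obtain ⟨_, hle⟩ := X.ideal (cubeToSpace h n G) (cubeToL0 n F) (abs_cubeToL0_le hFG)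
  exact hle

theorem norm_cubeToSpace_symmDiff (F : Finset ℕ → ℝ) {C : Finset ℕ} (hC : C ⊆ Finset.range n) :
    ‖cubeToSpace h n (fun B => F (symmDiff B C))‖ = ‖cubeToSpace h n F‖ := by
  obtain ⟨_, hle⟩ := X.symmetric (cubeToSpace h n F) (cubeToL0 n fun B => F (symmDiff B C))
    (fun t _ => rearrangement_cubeToL0_symmDiff F hC t)
  exact hle

theorem norm_cubeToSpace_cubeMean_le (S : Finset ℕ) (F : Finset ℕ → Finset ℕ → ℝ) :
    ‖cubeToSpace h n (fun B => cubeMean S fun C => F C B)‖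
      ≤ cubeMean S fun C => ‖cubeToSpace h n (F C)‖ := by
  have : (fun B => cubeMean S fun C => F C B) = (2 ^ S.card : ℝ)⁻¹ • ∑ C ∈ S.powerset, F C := by
    funext B
    simp [cubeMean, div_eq_inv_mul]
  rw [this, map_smul, map_sum, norm_smul, cubeMean, div_eq_inv_mul]
  simp only [norm_inv, norm_pow, Real.norm_ofNat]
  gcongr
  exact norm_sum_le _ _

/-- The average of `|F|` over all translations is the constant `m`, and each translate of `|F|` has
the same norm as `F`. -/
theorem cubeMean_abs_mul_norm_le (F : Finset ℕ → ℝ) :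
    cubeMean (Finset.range n) (fun B => |F B|) * ‖cubeToSpace h n fun _ => 1‖
      ≤ ‖cubeToSpace h n F‖ := by
  set m := cubeMean (Finset.range n) (fun B => |F B|) with hm
  have hm0 : 0 ≤ m := cubeMean_nonneg fun B _ => abs_nonneg _
  have h1 : ‖cubeToSpace h n fun _ => m‖ = m * ‖cubeToSpace h n fun _ => 1‖ := by
    have : (fun _ : Finset ℕ => m) = m • fun _ => (1 : ℝ) := by funext; simp
    rw [this, map_smul, norm_smul, Real.norm_of_nonneg hm0]
  rw [← h1]
  have h2 : cubeToSpace h n (fun _ => m)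
      = cubeToSpace h n (fun B => cubeMean (Finset.range n) fun C => |F (symmDiff B C)|) := by
    refine cubeToSpace_congr h fun B hB => ?_
    rw [hm, cubeMean, cubeMean]
    congr 1
    simp_rw [symmDiff_comm B]
    rw [sum_powerset_symmDiff hB fun B => |F B|]
  rw [h2]
  refine (norm_cubeToSpace_cubeMean_le h _ fun C B => |F (symmDiff B C)|).trans ?_
  rw [← cubeMean_const (Finset.range n) ‖cubeToSpace h n F‖]
  refine cubeMean_mono fun C hC => ?_
  rw [← norm_cubeToSpace_symmDiff h F hC]
  exact norm_cubeToSpace_le_of_abs_le h fun B _ => by rw [abs_abs]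

/-- Averaging over sign changes projects, with norm one, onto the span of the Walsh functions `w_A`
with a given trace on `S`. -/
theorem norm_cubeToSpace_sum_filter_le {ι : Type*} {S : Finset ℕ}
    (hS : S ⊆ Finset.range n) (T : Finset ℕ) (s : Finset ι) (a : ι → ℝ) (A : ι → Finset ℕ) :
    ‖cubeToSpace h n (fun B => ∑ i ∈ s with A i ∩ S = T ∩ S, a i * walsh (A i) B)‖
      ≤ ‖cubeToSpace h n (fun B => ∑ i ∈ s, a i * walsh (A i) B)‖ := by
  set F : Finset ℕ → ℝ := fun B => ∑ i ∈ s, a i * walsh (A i) B with hF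
  -- Translation by `C` multiplies `w_A` by `w_A(C)`. Orthogonality over `C ⊆ S` then selects the
  -- required traces.
  have h1 : (fun B => ∑ i ∈ s with A i ∩ S = T ∩ S, a i * walsh (A i) B)
      = fun B => cubeMean S fun C => walsh T C * F (symmDiff B C) := by
    funext B
    simp only [hF, Finset.mul_sum, walsh_symmDiff]
    rw [cubeMean_sum, Finset.sum_filter]
    refine Finset.sum_congr rfl fun i _ => ?_
    have : (fun C => walsh T C * (a i * (walsh (A i) B * walsh (A i) C)))
        = fun C => (a i * walsh (A i) B) * (walsh T C * walsh (A i) C) := by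
      funext C; ring
    rw [this, cubeMean_const_mul, cubeMean_walsh_mul_walsh]
    split_ifs <;> simp
  rw [h1]
  refine (norm_cubeToSpace_cubeMean_le h S fun C B => walsh T C * F (symmDiff B C)).trans ?_
  rw [← cubeMean_const S ‖cubeToSpace h n F‖]
  refine cubeMean_mono fun C hC => ?_
  rw [← norm_cubeToSpace_symmDiff h F (hC.trans hS)]
  exact norm_cubeToSpace_le_of_abs_le h fun B _ => by rw [abs_mul, abs_walsh, one_mul]

end SymmetricNorm

/-! ### Grünblum's criterion for basic sequences -/

section Banach

variable {E : Type*} [NormedAddCommGroup E] [NormedSpace ℝ E]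

theorem linearIndependent_of_norm_sum_range_le {x : ℕ → E} (hx : ∀ k, x k ≠ 0) {K : ℝ}
    (hK : ∀ (a : ℕ → ℝ) (m n : ℕ), m ≤ n →
      ‖∑ k ∈ Finset.range m, a k • x k‖ ≤ K * ‖∑ k ∈ Finset.range n, a k • x k‖) :
    LinearIndependent ℝ x := by
  rw [linearIndependent_iff']
  intro s g hg i hi
  set a : ℕ → ℝ := fun k => if k ∈ s then g k else 0 with ha
  obtain ⟨n, hn⟩ := s.exists_nat_subset_range
  have hsum : ∑ k ∈ Finset.range n, a k • x k = 0 := by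
    rw [← hg]
    simp only [ha, ite_smul, zero_smul]
    rw [Finset.sum_ite_mem, Finset.inter_eq_right.2 hn]
  have hpart : ∀ m ≤ n, ∑ k ∈ Finset.range m, a k • x k = 0 := by
    intro m hm
    have := hK a m n hm
    rw [hsum, norm_zero, mul_zero] at this
    exact norm_le_zero_iff.1 this
  have hin : i < n := Finset.mem_range.1 (hn hi)
  have h1 := hpart (i + 1) hin
  rw [Finset.sum_range_succ, hpart i hin.le, zero_add] at h1
  have h2 := (smul_eq_zero.1 h1).resolve_right (hx i)
  simpa [ha, hi] using h2

theorem LinearIndependent.eventually_sum_range_repr {x : ℕ → E} (hli : LinearIndependent ℝ x)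
    (v : Submodule.span ℝ (range x)) :
    ∀ᶠ n in atTop, ∑ k ∈ Finset.range n, hli.repr v k • x k = v := by
  obtain ⟨n, hn⟩ := (hli.repr v).support.exists_nat_subset_range
  filter_upwards [eventually_ge_atTop n] with m hm
  conv_rhs => rw [← hli.linearCombination_repr v]
  rw [Finsupp.linearCombination_apply, Finsupp.sum]
  symm
  refine Finset.sum_subset (hn.trans (Finset.range_mono hm)) fun k _ hk => ?_
  rw [Finsupp.notMem_support_iff.1 hk, zero_smul]

/-- Grünblum's criterion: nonzero vectors form a basic sequence if the initial partial sums of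
their linear combinations are uniformly bounded by the whole combination. -/
theorem isBasicSequence_of_norm_sum_range_le {x : ℕ → E} (hx : ∀ k, x k ≠ 0) {K : ℝ}
    (hK : ∀ (a : ℕ → ℝ) (m n : ℕ), m ≤ n →
      ‖∑ k ∈ Finset.range m, a k • x k‖ ≤ K * ‖∑ k ∈ Finset.range n, a k • x k‖) :
    IsBasicSequence x := by
  have hli := linearIndependent_of_norm_sum_range_le hx hK
  have hpart : ∀ (v : Submodule.span ℝ (range x)) (m : ℕ),
      ‖∑ k ∈ Finset.range m, hli.repr v k • x k‖ ≤ K * ‖(v : E)‖ := by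
    intro v m
    obtain ⟨n, hn, hmn⟩ := ((hli.eventually_sum_range_repr v).and (eventually_ge_atTop m)).exists
    rw [← hn]
    exact hK _ m n hmn
  have hcoord : ∀ (k : ℕ) (v : Submodule.span ℝ (range x)),
      ‖hli.repr v k‖ ≤ 2 * K / ‖x k‖ * ‖v‖ := by
    intro k v
    have hk : 0 < ‖x k‖ := norm_pos_iff.2 (hx k)
    rw [div_mul_eq_mul_div, le_div_iff₀ hk, ← norm_smul]
    have : hli.repr v k • x k = ∑ i ∈ Finset.range (k + 1), hli.repr v i • x i
        - ∑ i ∈ Finset.range k, hli.repr v i • x i := by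
      rw [Finset.sum_range_succ]; abel
    rw [this]
    refine (norm_sub_le _ _).trans ?_
    have h1 := hpart v (k + 1)
    have h2 := hpart v k
    rw [Submodule.coe_norm]
    linarith
  -- Hahn–Banach makes the partial sum operators continuous on all of `E`. The uniform bound `K` is
  -- needed, and obtained, only on the closed span.
  have hext : ∀ k, ∃ g : StrongDual ℝ E, ∀ v : Submodule.span ℝ (range x),
      g v = hli.repr v k := by
    intro k
    obtain ⟨g, hg, _⟩ := exists_extension_norm_eq (Submodule.span ℝ (range x))
      (((Finsupp.lapply k).comp hli.repr).mkContinuous (2 * K / ‖x k‖) (hcoord k))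
    exact ⟨g, hg⟩
  choose g hg using hext
  set W := (Submodule.span ℝ (range x)).topologicalClosure with hW
  have hxspan : ∀ k, x k ∈ Submodule.span ℝ (range x) := fun k =>
    Submodule.subset_span (mem_range_self k)
  set P : ℕ → E →L[ℝ] E := fun m => ∑ k ∈ Finset.range m, (g k).smulRight (x k) with hP
  have hPapply : ∀ m v, P m v = ∑ k ∈ Finset.range m, g k v • x k := by
    intro m v
    simp [hP]
  have hPspan : ∀ (v : Submodule.span ℝ (range x)) (m : ℕ),
      P m v = ∑ k ∈ Finset.range m, hli.repr v k • x k := by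
    intro v m
    simp only [hPapply, hg]
  have hPW : ∀ m, ∀ v ∈ W, ‖P m v‖ ≤ K * ‖v‖ := by
    intro m
    have hclosed : IsClosed {v : E | ‖P m v‖ ≤ K * ‖v‖} :=
      isClosed_le (by fun_prop) (by fun_prop)
    have hsub : closure (Submodule.span ℝ (range x) : Set E) ⊆ {v : E | ‖P m v‖ ≤ K * ‖v‖} := by
      refine closure_minimal (fun v hv => ?_) hclosed
      have := hpart ⟨v, hv⟩ m
      rw [← hPspan] at this
      exact this
    exact fun v hv => hsub hv
  -- On the span the partial sums are eventually exact; density and the uniform bound carry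
  -- convergence to the closure.
  have hlim : ∀ v ∈ W, Tendsto (fun m => P m v) atTop (𝓝 v) := by
    intro v hv
    rw [Metric.tendsto_atTop]
    intro ε hε
    have hδ : 0 < ε / (|K| + 1) := by positivity
    obtain ⟨w, hw, hvw⟩ := Metric.mem_closure_iff.1 hv _ hδ
    obtain ⟨M, hM⟩ := eventually_atTop.1 (hli.eventually_sum_range_repr ⟨w, hw⟩)
    refine ⟨M, fun m hm => ?_⟩
    have hPw : P m w = w := (hPspan ⟨w, hw⟩ m).trans (hM m hm)
    rw [dist_eq_norm] at hvw ⊢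
    have hmem : v - w ∈ W := W.sub_mem hv (Submodule.le_topologicalClosure _ hw)
    have e : P m v - v = P m (v - w) - (v - w) := by rw [map_sub, hPw]; abel
    rw [e]
    calc ‖P m (v - w) - (v - w)‖ ≤ ‖P m (v - w)‖ + ‖v - w‖ := norm_sub_le _ _
      _ ≤ K * ‖v - w‖ + ‖v - w‖ := by gcongr; exact hPW m _ hmem
      _ ≤ (|K| + 1) * ‖v - w‖ := by nlinarith [le_abs_self K, norm_nonneg (v - w)]
      _ < ε := by rw [mul_comm, ← lt_div_iff₀ (by positivity)]; exact hvw
  refine ⟨{ basis := fun k => ⟨x k, Submodule.le_topologicalClosure _ (hxspan k)⟩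
            coord := fun k => (g k).comp W.subtypeL
            ortho := ?_
            expansion := ?_ }, fun k => rfl⟩
  · intro i j
    change g i (x j) = _
    rw [hg i ⟨x j, hxspan j⟩, hli.repr_eq_single j _ rfl, Finsupp.single_eq_pi_single]
    congr!
  · intro v
    rw [HasSum, SummationFilter.conditional_filter_eq_map_range, tendsto_map'_iff,
      tendsto_subtype_rng]
    refine (hlim v v.2).congr fun m => ?_
    simp [hPapply]

end Banach

/-! ### The lexicographic order of `△^d` -/

section Triangle

variable {d : ℕ}

/-- The multi-index `j ∈ △^d` with its entries shifted to start from `0`. -/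
def Triangle.entry (j : Triangle d) (i : Fin d) : ℕ := (ofLex j.1 i).natPred

theorem Triangle.entry_strictAnti (j : Triangle d) : StrictAnti j.entry := fun _ _ h =>
  PNat.natPred_strictMono (j.2 h)

theorem Triangle.entry_injective : Function.Injective (Triangle.entry (d := d)) := by
  intro j k h
  refine Subtype.ext (ofLex.injective (funext fun i => PNat.natPred_injective ?_))
  exact congrFun h i

theorem Triangle.lt_iff (j q : Triangle d) :
    j < q ↔ ∃ i, (∀ l < i, j.entry l = q.entry l) ∧ j.entry i < q.entry i := by
  have : j < q ↔ ∃ i, (∀ l < i, ofLex j.1 l = ofLex q.1 l) ∧ ofLex j.1 i < ofLex q.1 i := Iff.rfl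
  rw [this]
  simp only [Triangle.entry, PNat.natPred_inj, PNat.natPred_lt_natPred]

/-- The set of Rademacher indices (counted from `0`) that occur in a multi-index. -/
def Triangle.support (j : Triangle d) : Finset ℕ := Finset.univ.image j.entry

theorem Triangle.card_support (j : Triangle d) : j.support.card = d := by
  rw [Triangle.support, Finset.card_image_of_injective _ j.entry_strictAnti.injective]
  simp

theorem Triangle.support_injective : Function.Injective (Triangle.support (d := d)) := by
  intro j k h
  refine Triangle.entry_injective ?_
  have hr : range j.entry = range k.entry := by
    have := congrArg (fun s : Finset ℕ => (s : Set ℕ)) h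
    simpa [Triangle.support] using this
  have := (StrictMono.range_inj (f := OrderDual.toDual ∘ j.entry)
    (g := OrderDual.toDual ∘ k.entry) j.entry_strictAnti k.entry_strictAnti).1
    (by rw [range_comp, range_comp, hr])
  exact this

/-- The condition that the first difference of the multi-indices `p` and `q` is at `i`, where `p` is
smaller, in terms of the underlying sets. -/
theorem image_inter_eq_iff {p q : Fin d → ℕ} (hp : StrictAnti p) (hq : StrictAnti q) {n : ℕ}
    (hpn : ∀ i, p i < n) (hqn : ∀ i, q i < n) (i : Fin d) :
    Finset.univ.image p ∩ Finset.Ico (q i) n = (Finset.Iio i).image q ∩ Finset.Ico (q i) n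
      ↔ (∀ l < i, p l = q l) ∧ p i < q i := by
  constructor
  · intro h
    have hpq : ∀ l, q i ≤ p l → ∃ k < i, q k = p l := by
      intro l hl
      have : p l ∈ (Finset.Iio i).image q ∩ Finset.Ico (q i) n := by
        rw [← h]
        simp [hl, hpn]
      simpa using (Finset.mem_inter.1 this).1
    have hqp : ∀ l < i, ∃ k, p k = q l := by
      intro l hl
      have : q l ∈ Finset.univ.image p ∩ Finset.Ico (q i) n := by
        rw [h]
        simp only [Finset.mem_inter, Finset.mem_image, Finset.mem_Iio, Finset.mem_Ico]
        exact ⟨⟨l, hl, rfl⟩, hq.antitone hl.le, hqn l⟩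
      simpa using (Finset.mem_inter.1 this).1
    have heq : ∀ l < i, p l = q l := by
      intro l
      induction l using WellFoundedLT.induction with
      | _ l ih =>
        intro hl
        have ih' : ∀ k < l, p k = q k := fun k hk => ih k hk (hk.trans hl)
        -- The larger of `p l`, `q l` must occur in the other tuple. Positions before `l` are
        -- excluded by injectivity, since the tuples agree there, and later positions by
        -- monotonicity.
        rcases lt_trichotomy (p l) (q l) with hlt | heq | hgt
        · obtain ⟨k, hk⟩ := hqp l hl
          rcases lt_or_ge k l with hkl | hkl
          · rw [ih' k hkl] at hk
            exact absurd (hq.injective hk) hkl.ne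
          · have := hp.antitone hkl
            omega
        · exact heq
        · obtain ⟨k, _, hk⟩ := hpq l ((hq.antitone hl.le).trans hgt.le)
          rcases lt_or_ge k l with hkl | hkl
          · rw [← ih' k hkl] at hk
            exact absurd (hp.injective hk) hkl.ne
          · have := hq.antitone hkl
            omega
    refine ⟨heq, ?_⟩
    by_contra! hcon
    obtain ⟨k, hki, hk⟩ := hpq i hcon
    rw [← heq k hki] at hk
    exact absurd (hp.injective hk) hki.ne
  · rintro ⟨heq, hlt⟩
    ext x
    simp only [Finset.mem_inter, Finset.mem_image, Finset.mem_univ, true_and, Finset.mem_Iio,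
      Finset.mem_Ico]
    constructor
    · rintro ⟨⟨l, rfl⟩, h1, h2⟩
      refine ⟨?_, h1, h2⟩
      have hli : l < i := by
        by_contra! hil
        have := hp.antitone hil
        omega
      exact ⟨l, hli, (heq l hli).symm⟩
    · rintro ⟨⟨l, hli, rfl⟩, h1, h2⟩
      exact ⟨⟨l, heq l hli⟩, h1, h2⟩

/-- The first entry is the largest, and in a lexicographic predecessor it is at most the first entry
of `q`. -/
theorem Triangle.finite_Iic (hd : 1 ≤ d) (q : Triangle d) : (Iic q).Finite := by
  have hfin : (Set.pi univ fun _ : Fin d => Iic (q.entry ⟨0, hd⟩)).Finite :=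
    Set.Finite.pi fun _ => Set.finite_Iic _
  refine (hfin.preimage Triangle.entry_injective.injOn).subset fun j hj => ?_
  rw [mem_preimage, mem_univ_pi]
  intro i
  have h0 : j.entry i ≤ j.entry ⟨0, hd⟩ :=
    j.entry_strictAnti.antitone (Fin.mk_le_of_le_val (Nat.zero_le _))
  refine h0.trans ?_
  rcases (mem_Iic.1 hj).eq_or_lt with rfl | hlt
  · exact le_rfl
  · obtain ⟨l, heq, hl⟩ := (Triangle.lt_iff _ _).1 hlt
    rcases Nat.eq_zero_or_pos l.1 with h | h
    · have : l = ⟨0, hd⟩ := Fin.ext h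
      rw [← this]; exact hl.le
    · exact (heq ⟨0, hd⟩ h).le

/-- The multi-index `(m + d, m + d - 1, …, m + 1)`. -/
def Triangle.shifted (d m : ℕ) : Triangle d :=
  ⟨toLex fun i => Nat.succPNat (m + d - 1 - i), fun i k h => by
    change Nat.succPNat (m + d - 1 - k) < Nat.succPNat (m + d - 1 - i)
    rw [Nat.succPNat_lt_succPNat]
    have := k.2
    have : i.1 < k.1 := h
    omega⟩

theorem Triangle.exists_gt (hd : 1 ≤ d) (q : Triangle d) : ∃ j, q < j := by
  refine ⟨Triangle.shifted d (q.entry ⟨0, hd⟩ + 1), (Triangle.lt_iff _ _).2 ⟨⟨0, hd⟩, ?_, ?_⟩⟩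
  · intro l hl
    exact absurd hl (Nat.not_lt_zero l.1)
  · simp only [Triangle.shifted, Triangle.entry, ofLex_toLex, Nat.natPred_succPNat]
    omega

/-- For `d ≥ 1` the lexicographic order of `△^d` has the order type of `ℕ`. -/
theorem Triangle.nonempty_orderIso_nat (hd : 1 ≤ d) : Nonempty (ℕ ≃o Triangle d) := by
  have : Nonempty (Triangle d) := ⟨Triangle.shifted d 0⟩
  have : NoMaxOrder (Triangle d) := ⟨Triangle.exists_gt hd⟩
  let _ : LocallyFiniteOrder (Triangle d) := LocallyFiniteOrder.ofFiniteIcc fun a b =>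
    (Triangle.finite_Iic hd b).subset Icc_subset_Iic_self
  let _ : SuccOrder (Triangle d) := LinearLocallyFiniteOrder.succOrder (Triangle d)
  let _ : PredOrder (Triangle d) := LinearLocallyFiniteOrder.predOrder (Triangle d)
  obtain ⟨m, hm⟩ : ∃ m : Triangle d, ∀ j, m ≤ j := by
    set q := Triangle.shifted d 0
    obtain ⟨m, hmq, hm⟩ := Set.exists_min_image (Iic q) id (Triangle.finite_Iic hd q)
      ⟨q, mem_Iic.2 le_rfl⟩
    refine ⟨m, fun j => ?_⟩
    rcases le_total j q with h | h
    · exact hm j h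
    · exact (mem_Iic.1 hmq).trans h
  let _ : OrderBot (Triangle d) := { bot := m, bot_le := hm }
  exact ⟨(orderIsoNatOfLinearSuccPredArch (ι := Triangle d)).symm⟩

end Triangle

/-! ### The Rademacher chaos in a symmetric space -/

theorem chaos_eq_cubeToL0 {d n : ℕ} (j : Triangle d) (hj : j.support ⊆ Finset.range n) :
    chaos j = cubeToL0 n (walsh j.support) := by
  refine AEEqFun.mk_eq_mk.2 (Eventually.of_forall fun t => ?_)
  simp only
  rw [walsh, Triangle.support, Finset.prod_image j.entry_strictAnti.injective.injOn]
  refine Finset.prod_congr rfl fun i _ => ?_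
  have hi : j.entry i < n :=
    Finset.mem_range.1 (hj (Finset.mem_image_of_mem _ (Finset.mem_univ i)))
  rw [← rademacher_succ hi t, Triangle.entry, PNat.natPred_add_one]

section Estimates

variable {X : SymmetricSpace}

/-- A symmetric space norm dominates the `ℓ²` norm of the coefficients of a Walsh polynomial of
degree at most `d`. -/
theorem sqrt_sum_sq_le_norm_cubeToSpace (h : ∀ n F, cubeToL0 n F ∈ X.carrier)
    {ι : Type*} {n d : ℕ} {s : Finset ι} (a : ι → ℝ)
    {A : ι → Finset ℕ} (hA : Function.Injective A) (hAn : ∀ k ∈ s, A k ⊆ Finset.range n)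
    (hcard : ∀ k, (A k).card ≤ d) :
    √(∑ k ∈ s, a k ^ 2) * ‖cubeToSpace h n fun _ => 1‖
      ≤ 3 ^ d * ‖cubeToSpace h n fun B => ∑ k ∈ s, a k * walsh (A k) B‖ := by
  classical
  -- Coefficients are reindexed by sets; injectivity of `A` prevents any from merging.
  set c : Finset ℕ → ℝ := fun T => ∑ k ∈ s, if A k = T then a k else 0 with hc
  have hcA : ∀ k ∈ s, c (A k) = a k := by
    intro k hk
    simp only [hc, hA.eq_iff]
    rw [Finset.sum_ite_eq' s k a, if_pos hk]
  have hc0 : ∀ T, T ∉ s.image A → c T = 0 := by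
    intro T hT
    refine Finset.sum_eq_zero fun k hk => if_neg fun hkT => hT ?_
    exact Finset.mem_image.2 ⟨k, hk, hkT⟩
  have hsub : s.image A ⊆ (Finset.range n).powerset := by
    intro T hT
    obtain ⟨k, hk, rfl⟩ := Finset.mem_image.1 hT
    exact Finset.mem_powerset.2 (hAn k hk)
  have hdeg : ∀ T ⊆ Finset.range n, d < T.card → c T = 0 := by
    intro T _ hT
    refine hc0 T fun hmem => ?_
    obtain ⟨k, _, rfl⟩ := Finset.mem_image.1 hmem
    exact absurd (hcard k) (not_le.2 hT)
  have hsq : ∑ T ∈ (Finset.range n).powerset, c T ^ 2 = ∑ k ∈ s, a k ^ 2 := by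
    rw [← Finset.sum_subset hsub fun T _ hT => by rw [hc0 T hT]; norm_num,
      Finset.sum_image hA.injOn]
    exact Finset.sum_congr rfl fun k hk => by rw [hcA k hk]
  have hF : walshSum (Finset.range n) c = fun B => ∑ k ∈ s, a k * walsh (A k) B := by
    funext B
    rw [walshSum, ← Finset.sum_subset hsub fun T _ hT => by rw [hc0 T hT, zero_mul],
      Finset.sum_image hA.injOn]
    exact Finset.sum_congr rfl fun k hk => by rw [hcA k hk]
  have hL1 := le_cubeMean_abs_walshSum (Finset.range n) d c hdeg
  rw [hsq] at hL1
  rw [← hF]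
  calc _ ≤ 3 ^ d * cubeMean (Finset.range n) (fun B => |walshSum (Finset.range n) c B|)
        * ‖cubeToSpace h n fun _ => 1‖ := by gcongr
    _ = 3 ^ d * (cubeMean (Finset.range n) (fun B => |walshSum (Finset.range n) c B|)
        * ‖cubeToSpace h n fun _ => 1‖) := by ring
    _ ≤ _ := by gcongr; exact cubeMean_abs_mul_norm_le h _

/-- If `Exp L²` embeds into `X`, the mean over signs of the `X`-norm of a Walsh polynomial is
dominated by the `ℓ²` norm of its coefficients. -/
theorem exists_cubeMean_norm_cubeToSpace_le (h : ∀ n F, cubeToL0 n F ∈ X.carrier)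
    {N : ℝ → ℝ} (hN : GeneratesExpL 2 N)
    (hX : OrliczEmbeds N X) :
    ∃ M : ℝ, 0 < M ∧ ∀ (n m : ℕ) (a : ℕ → ℝ) (A : ℕ → Finset ℕ),
      cubeMean (Finset.range m) (fun C => ‖cubeToSpace h n fun B =>
          ∑ k ∈ Finset.range m, coordSign k C * a k * walsh (A k) B‖)
        ≤ M * √(∑ k ∈ Finset.range m, a k ^ 2) := by
  obtain ⟨L, hL, hemb⟩ := hX
  -- The scale `c = q v` turns the exponent `α (F/c)²` into `(F/v)² / (2e)`. The value `l = 1/(2e)`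
  -- is the largest that `cubeMean_exp_sq_le` admits for coefficients of `ℓ²` norm one.
  obtain ⟨α, K, hα, hK, hexp⟩ := hN.exists_le_exp_sq
  set q := √(2 * Real.exp 1 * α) with hq
  have hq0 : 0 < q := Real.sqrt_pos.2 (by positivity)
  have hq2 : q ^ 2 = 2 * Real.exp 1 * α := Real.sq_sqrt (by positivity)
  refine ⟨L * (q * (1 + K * Real.exp (1 / 2))), by positivity, fun n m a A => ?_⟩
  set V := ∑ k ∈ Finset.range m, a k ^ 2 with hV
  have hV0 : 0 ≤ V := Finset.sum_nonneg fun _ _ => sq_nonneg _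
  set F : Finset ℕ → Finset ℕ → ℝ :=
    fun C B => ∑ k ∈ Finset.range m, coordSign k C * a k * walsh (A k) B with hF
  rcases hV0.eq_or_lt with hz | hpos
  · have ha : ∀ k ∈ Finset.range m, a k = 0 := fun k hk =>
      pow_eq_zero_iff two_ne_zero |>.1
        ((Finset.sum_eq_zero_iff_of_nonneg fun _ _ => sq_nonneg _).1 hz.symm k hk)
    have hF0 : ∀ C, F C = 0 := fun C => funext fun B =>
      Finset.sum_eq_zero fun k hk => by rw [ha k hk]; ring
    change cubeMean _ (fun C => ‖cubeToSpace h n (F C)‖) ≤ _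
    simp only [hF0, map_zero, norm_zero, cubeMean_const]
    positivity
  set v := √V with hv
  have hv0 : 0 < v := Real.sqrt_pos.2 hpos
  have hvV : v ^ 2 = V := Real.sq_sqrt hV0
  set c := q * v with hc
  have hc0 : 0 < c := by positivity
  have hnorm : ∀ C, ‖cubeToSpace h n (F C)‖
      ≤ L * (c * (1 + cubeMean (Finset.range n) fun B => N (|F C B| / c))) := by
    intro C
    obtain ⟨_, hle⟩ := hemb (cubeToL0 n (F C)) (memOrlicz_cubeToL0 hN.orlicz.nonneg n (F C))
    refine le_trans hle ?_
    gcongr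
    exact orliczNorm_cubeToL0_le hN.orlicz n (F C) hc0
  -- For fixed `B`, `F C B / v` is a Rademacher sum in `C` with normalized coefficients, since Walsh
  -- functions have modulus one.
  have hpoint : ∀ B, cubeMean (Finset.range m) (fun C => N (|F C B| / c))
      ≤ K * Real.exp (1 / 2) := by
    intro B
    set b : ℕ → ℝ := fun k => a k * walsh (A k) B / v with hb
    have hb1 : ∑ k ∈ Finset.range m, b k ^ 2 = 1 := by
      have : ∀ k, b k ^ 2 = a k ^ 2 / V := by
        intro k
        rw [hb]
        simp only
        rw [div_pow, mul_pow, hvV, ← sq_abs (walsh _ _), abs_walsh]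
        ring
      simp only [this]
      rw [← Finset.sum_div, ← hV, div_self hpos.ne']
    have hsub := cubeMean_exp_sq_le (Finset.range m) b (1 / (2 * Real.exp 1)) (by positivity)
      (by rw [hb1]; field_simp; exact le_rfl)
    rw [hb1] at hsub
    calc cubeMean (Finset.range m) (fun C => N (|F C B| / c))
        ≤ cubeMean (Finset.range m) (fun C => K * Real.exp (1 / (2 * Real.exp 1)
            * (∑ k ∈ Finset.range m, coordSign k C * b k) ^ 2)) := by
          refine cubeMean_mono fun C _ => ?_
          refine (hexp _ (by positivity)).trans (le_of_eq ?_)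
          have hFb : ∑ k ∈ Finset.range m, coordSign k C * b k = F C B / v := by
            rw [hF, Finset.sum_div]
            exact Finset.sum_congr rfl fun k _ => by rw [hb]; ring
          rw [hFb, div_pow, div_pow, sq_abs, hc, mul_pow, hq2]
          congr 2
          field_simp
      _ ≤ K * Real.exp (1 / 2) := by
          rw [cubeMean_const_mul]
          gcongr
  calc cubeMean (Finset.range m) (fun C => ‖cubeToSpace h n (F C)‖)
      ≤ cubeMean (Finset.range m) (fun C =>
          L * (c * (1 + cubeMean (Finset.range n) fun B => N (|F C B| / c)))) :=
        cubeMean_mono fun C _ => hnorm C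
    _ = L * (c * (1 + cubeMean (Finset.range n) fun B =>
          cubeMean (Finset.range m) fun C => N (|F C B| / c))) := by
        rw [cubeMean_const_mul, cubeMean_const_mul, cubeMean_add, cubeMean_const, cubeMean_comm]
    _ ≤ L * (c * (1 + K * Real.exp (1 / 2))) := by
        gcongr
        rw [← cubeMean_const (Finset.range n) (K * Real.exp (1 / 2))]
        exact cubeMean_mono fun B _ => hpoint B
    _ = _ := by rw [hc]; ring

theorem exists_support_subset_range {d : ℕ} (e : ℕ → Triangle d) (m : ℕ) :
    ∃ n, ∀ k < m, (e k).support ⊆ Finset.range n := by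
  obtain ⟨n, hn⟩ := ((Finset.range m).biUnion fun k => (e k).support).exists_nat_subset_range
  exact ⟨n, fun k hk => (Finset.subset_biUnion_of_mem (fun k => (e k).support)
    (Finset.mem_range.2 hk)).trans hn⟩

theorem sum_smul_eq_cubeToSpace (h : ∀ n F, cubeToL0 n F ∈ X.carrier)
    {d : ℕ} {y : Triangle d → X.carrier}
    (hy : ∀ j, (y j : L0) = chaos j) {e : ℕ → Triangle d} {n : ℕ} {s : Finset ℕ}
    (hn : ∀ k ∈ s, (e k).support ⊆ Finset.range n) (a : ℕ → ℝ) :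
    ∑ k ∈ s, a k • y (e k)
      = cubeToSpace h n fun B => ∑ k ∈ s, a k * walsh (e k).support B := by
  have h1 : (fun B => ∑ k ∈ s, a k * walsh (e k).support B)
      = ∑ k ∈ s, a k • walsh (e k).support := by
    funext B; simp
  rw [h1, map_sum]
  refine Finset.sum_congr rfl fun k hk => ?_
  rw [map_smul]
  congr 1
  exact Subtype.ext ((hy _).trans (chaos_eq_cubeToL0 _ (hn k hk)))

/-- The constant function `1` is the same element of `X` for each number of coordinates. -/
theorem norm_cubeToSpace_one (h : ∀ n F, cubeToL0 n F ∈ X.carrier)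
    (n : ℕ) :
    ‖cubeToSpace h n fun _ => 1‖ = ‖cubeToSpace h 0 fun _ => 1‖ := rfl

theorem norm_cubeToSpace_one_pos (h : ∀ n F, cubeToL0 n F ∈ X.carrier) :
    0 < ‖cubeToSpace h 0 fun _ => 1‖ := by
  rw [norm_pos_iff]
  intro h0
  have h1 : cubeToL0 0 (fun _ => 1) = 0 := congrArg Subtype.val h0
  have h2 := coeFn_cubeToL0 0 fun _ => 1
  rw [h1] at h2
  have h3 : ∀ᵐ _ : I, False := by
    filter_upwards [h2, AEEqFun.coeFn_zero (α := I) (β := ℝ) (μ := volume)] with t ht ht'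
    rw [ht'] at ht
    simp at ht
  exact h3.exists.choose_spec

/-- Both sides are compared with the `ℓ²` norm of the coefficients. The constants do not involve
`e`, so `D` is chosen before it. -/
theorem exists_RUCEstimate_chaos (h : ∀ n F, cubeToL0 n F ∈ X.carrier)
    {N : ℝ → ℝ} (hN : GeneratesExpL 2 N) (hX : OrliczEmbeds N X) {d : ℕ}
    {y : Triangle d → X.carrier} (hy : ∀ j, (y j : L0) = chaos j) :
    ∃ D : ℝ, 0 < D ∧ ∀ e : ℕ ≃ Triangle d, RUCEstimate D fun k => y (e k) := by
  obtain ⟨M, hM, hup⟩ := exists_cubeMean_norm_cubeToSpace_le h hN hX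
  set κ := ‖cubeToSpace h 0 fun _ => 1‖ with hκ
  have hκ0 : 0 < κ := norm_cubeToSpace_one_pos h
  refine ⟨M * (3 ^ d / κ), by positivity, fun e m a => ?_⟩
  obtain ⟨n, hn⟩ := exists_support_subset_range e m
  have hn' : ∀ k ∈ Finset.range m, (e k).support ⊆ Finset.range n := fun k hk =>
    hn k (Finset.mem_range.1 hk)
  have hint : ∫ u : I, ‖∑ k ∈ Finset.range m, (rademacher (k + 1) u * a k) • y (e k)‖
      = cubeMean (Finset.range m) (fun C => ‖cubeToSpace h n fun B =>
          ∑ k ∈ Finset.range m, coordSign k C * a k * walsh (e k).support B‖) := by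
    rw [← integral_rademacherBits m fun C => norm_nonneg _]
    congr 1
    funext u
    rw [sum_smul_eq_cubeToSpace h hy hn' fun k => rademacher (k + 1) u * a k]
    congr 2
    funext B
    exact Finset.sum_congr rfl fun k hk => by rw [rademacher_succ (Finset.mem_range.1 hk) u]
  rw [hint, sum_smul_eq_cubeToSpace h hy hn']
  have hlow := sqrt_sum_sq_le_norm_cubeToSpace h a (A := fun k => (e k).support)
    (Triangle.support_injective.comp e.injective) hn' (fun k => (e k).card_support.le)
  rw [norm_cubeToSpace_one, ← hκ, ← le_div_iff₀ hκ0] at hlow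
  refine (hup n m a fun k => (e k).support).trans ?_
  rw [mul_assoc]
  gcongr
  refine hlow.trans (le_of_eq ?_)
  ring

theorem norm_sum_range_chaos_le (h : ∀ n F, cubeToL0 n F ∈ X.carrier)
    {d : ℕ} (hd : 1 ≤ d) {y : Triangle d → X.carrier}
    (hy : ∀ j, (y j : L0) = chaos j) (e : ℕ ≃o Triangle d) (a : ℕ → ℝ) {m N : ℕ} (hmN : m ≤ N) :
    ‖∑ k ∈ Finset.range m, a k • y (e k)‖ ≤ d * ‖∑ k ∈ Finset.range N, a k • y (e k)‖ := by
  -- The case `m = N` is separate because `e m` must be among the first `N` multi-indices for its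
  -- entries to lie below `n`.
  rcases hmN.eq_or_lt with rfl | hlt
  · exact le_mul_of_one_le_left (norm_nonneg _) (by exact_mod_cast hd)
  set q := e m with hq
  obtain ⟨n, hn⟩ := exists_support_subset_range e N
  have hn' : ∀ k ∈ Finset.range N, (e k).support ⊆ Finset.range n := fun k hk =>
    hn k (Finset.mem_range.1 hk)
  have hentry : ∀ k < N, ∀ i, (e k).entry i < n := fun k hk i =>
    Finset.mem_range.1 (hn k hk (Finset.mem_image_of_mem _ (Finset.mem_univ i)))
  set S : Fin d → Finset ℕ := fun i => Finset.Ico (q.entry i) n with hS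
  set T : Fin d → Finset ℕ := fun i => (Finset.Iio i).image q.entry with hT
  have hiff : ∀ k ∈ Finset.range N, ∀ i, (e k).support ∩ S i = T i ∩ S i ↔
      (∀ l < i, (e k).entry l = q.entry l) ∧ (e k).entry i < q.entry i := fun k hk i =>
    image_inter_eq_iff (e k).entry_strictAnti q.entry_strictAnti
      (hentry k (Finset.mem_range.1 hk)) (hentry m hlt) i
  -- Since `e` preserves order, `k < m` means that `e k` precedes `q`. The position of the first
  -- difference splits these `k` into disjoint classes.
  have hdecomp : ∑ k ∈ Finset.range m, a k • y (e k)
      = ∑ i, ∑ k ∈ Finset.range N with (e k).support ∩ S i = T i ∩ S i, a k • y (e k) := by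
    have hdisj : ((Finset.univ : Finset (Fin d)) : Set (Fin d)).PairwiseDisjoint fun i =>
        (Finset.range N).filter fun k => (e k).support ∩ S i = T i ∩ S i := by
      have haux : ∀ i i' : Fin d, i < i' → ∀ k ∈ Finset.range N,
          (e k).support ∩ S i = T i ∩ S i → (e k).support ∩ S i' = T i' ∩ S i' → False := by
        intro i i' hii k hk h1 h2
        have h1 := ((hiff k hk i).1 h1).2
        have h2 := ((hiff k hk i').1 h2).1 i hii
        omega
      intro i _ i' _ hne
      refine Finset.disjoint_left.2 fun k hk hk' => ?_
      rw [Finset.mem_filter] at hk hk'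
      rcases lt_or_gt_of_ne hne with hlt | hlt
      · exact haux i i' hlt k hk.1 hk.2 hk'.2
      · exact haux i' i hlt k hk.1 hk'.2 hk.2
    rw [← Finset.sum_biUnion hdisj]
    refine Finset.sum_congr ?_ fun _ _ => rfl
    ext k
    simp only [Finset.mem_biUnion, Finset.mem_univ, true_and, Finset.mem_filter]
    rw [Finset.mem_range, ← e.lt_iff_lt, Triangle.lt_iff]
    constructor
    · rintro ⟨i, hi⟩
      have hk : k < m := e.lt_iff_lt.1 ((Triangle.lt_iff _ _).2 ⟨i, hi⟩)
      have hkN := Finset.mem_range.2 (hk.trans hlt)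
      exact ⟨i, hkN, (hiff k hkN i).2 hi⟩
    · rintro ⟨i, hk, hi⟩
      exact ⟨i, (hiff k hk i).1 hi⟩
  rw [hdecomp]
  calc _ ≤ ∑ i : Fin d, ‖∑ k ∈ Finset.range N with (e k).support ∩ S i = T i ∩ S i,
          a k • y (e k)‖ := norm_sum_le _ _
    _ ≤ ∑ _i : Fin d, ‖∑ k ∈ Finset.range N, a k • y (e k)‖ := by
        refine Finset.sum_le_sum fun i _ => ?_
        rw [sum_smul_eq_cubeToSpace h hy hn', sum_smul_eq_cubeToSpace h hy fun k hk =>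
          hn' k (Finset.mem_of_mem_filter k hk)]
        have hSn : S i ⊆ Finset.range n := fun x hx =>
          Finset.mem_range.2 (Finset.mem_Ico.1 hx).2
        exact norm_cubeToSpace_sum_filter_le h hSn (T i) _ a fun k => (e k).support
    _ = _ := by simp

theorem chaos_ne_zero (h : ∀ n F, cubeToL0 n F ∈ X.carrier) {d : ℕ} {y : Triangle d → X.carrier}
    (hy : ∀ j, (y j : L0) = chaos j) (j : Triangle d) : y j ≠ 0 := by
  obtain ⟨n, hn⟩ := j.support.exists_nat_subset_range
  have h1 : y j = cubeToSpace h n (walsh j.support) :=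
    Subtype.ext ((hy j).trans (chaos_eq_cubeToL0 j hn))
  rw [h1, ← norm_pos_iff]
  refine (norm_cubeToSpace_one_pos h).trans_le ?_
  rw [← norm_cubeToSpace_one h n]
  exact norm_cubeToSpace_le_of_abs_le h fun B _ => by rw [abs_walsh, abs_one]

end Estimates

theorem corollary2 (d : ℕ) (hd : 1 ≤ d) (X : SymmetricSpace)
    (N : ℝ → ℝ) (hN : GeneratesExpL 2 N) (hX : OrliczEmbeds N X) :
    ∃ y : Triangle d → X.carrier, (∀ j, (y j : L0) = chaos j) ∧
      (∃ e : ℕ ≃o Triangle d, IsRUCSequence (fun k => y (e k))) ∧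
      ∃ D : ℝ, 0 < D ∧ ∀ e : ℕ ≃ Triangle d, RUCEstimate D (fun k => y (e k)) := by
  have h : ∀ n F, cubeToL0 n F ∈ X.carrier := by
    obtain ⟨_, _, hemb⟩ := hX
    intro n F
    exact (hemb _ (memOrlicz_cubeToL0 hN.orlicz.nonneg n F)).choose
  have hmem : ∀ j : Triangle d, chaos j ∈ X.carrier := by
    intro j
    obtain ⟨n, hn⟩ := j.support.exists_nat_subset_range
    rw [chaos_eq_cubeToL0 j hn]
    exact h _ _
  set y : Triangle d → X.carrier := fun j => ⟨chaos j, hmem j⟩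
  have hy : ∀ j, (y j : L0) = chaos j := fun _ => rfl
  obtain ⟨D, hD, hRUC⟩ := exists_RUCEstimate_chaos h hN hX hy
  obtain ⟨e⟩ := Triangle.nonempty_orderIso_nat hd
  refine ⟨y, hy, ⟨e, ?_, D, hD, hRUC e.toEquiv⟩, D, hD, hRUC⟩
  exact isBasicSequence_of_norm_sum_range_le (fun k => chaos_ne_zero h hy (e k))
    fun a _ _ hmn => norm_sum_range_chaos_le h hd hy e a hmn
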